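/- Notation. Let $\mathfrak H$ be the complex upper half-plane, $e(x)=\exp(2\pi i x)$, $q=e(\tau)$ and $\zeta=e(z)$ for $\tau\in\mathfrak H$, $z\in\mathbb C$. For a lattice $L=[\omega_1,\omega_2]=\mathbb Z\omega_1+\mathbb Z\omega_2\subset\mathbb C$ let $$\zeta(z,L)=\frac1z+\sum_{\omega\in L\setminus\{0\}}\Big(\frac1{z-\omega}+\frac1\omega+\frac z{\omega^2}\Big)$$ be the Weierstrass zeta function; for $\omega\in L$ let $\eta(\omega,L)$ be the constant with $\zeta(z+\omega,L)=\zeta(z,L)+\eta(\omega,L)$, and put $\eta(r_1\omega_1+r_2\omega_2,L)=r_1\eta(\omega_1,L)+r_2\eta(\omega_2,L)$ for $r_1,r_2\in\mathbb R$. Let $\psi(z,L)=-1$ if $z\in L\setminus 2L$ and $\psi(z,L)=1$ otherwise. Put $\rho(\tau,z)=\exp\big(\tfrac12\eta(1,[\tau,1])z^2-\pi i z\big)$. For $k\in\mathbb Z$, $\phi:\mathfrak H\times\mathbb C\to\mathbb C$, $M=\begin{pmatrix}a&b\\c&d\end{pmatrix}\in SL_2(\mathbb Z)$ and $(\lambda,\mu)\in\mathbb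 R^2$, with $\omega=\lambda\tau+\mu$, let $$(\phi|'_kM)(\tau,z)=(c\tau+d)^{-k}\phi\Big(\frac{a\tau+b}{c\tau+d},\frac z{c\tau+d}\Big),\qquad (\phi|''_k(\lambda,\mu))(\tau,z)=\Big(\psi(\omega,[\tau,1])\exp\big(\eta(\omega,[\tau,1])(z+\tfrac12\omega)\big)\Big)^k\phi(\tau,z+\omega).$$ Let $J_k=J_k(SL_2(\mathbb Z))$ be the complex vector space of holomorphic functions $\phi:\mathfrak H\times\mathbb C\to\mathbb C$ such that (i) $\phi|'_kM=\phi$ for all $M\in SL_2(\mathbb Z)$, (ii) $\phi|''_kX=\phi$ for all $X\in\mathbb Z^2$, and (iii) for each $M\in SL_2(\mathbb Z)$ the function $\rho^k(\phi|'_kM)$ has a Fourier development $$\sum_{n\ge0}\ \sum_{|r|\le r_0(n)}c(n,r)q^n\zeta^r \qquad(*)$$ for some (weakly) increasing sequence $(r_0(n))_{n\ge0}$ of nonnegative integers with $r_0(n)/n\to0$ as $n\to\infty$. For an integer $m>0$ let $J_k^m\subset J_k$ be the subspace consisting of $0$ and of all $\phi\in J_k$ for which $\rho^k\phi$ has a Fourier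 development $(*)$, with a sequence $r_0$ as in (iii), such that $$\min\{n-r_0(n):n\ge0\}+\frac k8\ge-m.$$ Theorem. Let $k<0$ and $m>0$ be integers. Then $J_k^m$ is a finite-dimensional complex vector space. -/

import Mathlib

noncomputable section

namespace ModifiedJacobi

open Filter Topology UpperHalfPlane
open scoped MatrixGroups

/-! ### The Weierstrass zeta function and the quasi-period map of a lattice -/

/-- The Weierstrass zeta function
`1 / z + ∑_{l ∈ L, l ≠ 0} (1 / (z - l) + 1 / l + z / l ^ 2)` of a lattice `L`. Since `1 / 0 = 0`,
the term of index `l = 0` of the sum below is `1 / z`. -/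
def weierstrassZeta (L : PeriodPair) (z : ℂ) : ℂ :=
  ∑' l : L.lattice, (1 / (z - l) + 1 / (l : ℂ) + z / (l : ℂ) ^ 2)

lemma weierstrassZeta_bound (r : ℝ) (hr : 0 < r) (s : ℂ) (hs : ‖s‖ < r) (l : ℂ)
    (h : 2 * r ≤ ‖l‖) :
    ‖1 / (s - l) + 1 / l + s / l ^ 2‖ ≤ 2 * r ^ 2 * ‖l‖ ^ (-3 : ℝ) := by
  have hl : 0 < ‖l‖ := by linarith
  have hl0 : l ≠ 0 := norm_pos_iff.mp hl
  have hsl : s - l ≠ 0 := by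
    intro e
    obtain rfl := sub_eq_zero.mp e
    linarith
  have hlow : ‖l‖ / 2 ≤ ‖s - l‖ := by
    rw [norm_sub_rev]
    exact le_trans (by linarith) (norm_sub_norm_le l s)
  have e : 1 / (s - l) + 1 / l + s / l ^ 2 = s ^ 2 / ((s - l) * l ^ 2) := by
    field_simp
    ring
  rw [e, norm_div, norm_mul, norm_pow, norm_pow]
  calc ‖s‖ ^ 2 / (‖s - l‖ * ‖l‖ ^ 2) ≤ r ^ 2 / (‖l‖ / 2 * ‖l‖ ^ 2) := by gcongr
    _ = 2 * r ^ 2 / ‖l‖ ^ 3 := by field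
    _ = _ := by norm_cast

lemma hasSumLocallyUniformly_weierstrassZeta (L : PeriodPair) :
    HasSumLocallyUniformly
      (fun (l : L.lattice) (z : ℂ) ↦ 1 / (z - l) + 1 / (l : ℂ) + z / (l : ℂ) ^ 2)
      (weierstrassZeta L) := by
  refine L.hasSumLocallyUniformly_aux (u := fun r l ↦ 2 * r ^ 2 * ‖l‖ ^ (-3 : ℝ)) _
    (fun _ _ ↦ (ZLattice.summable_norm_rpow _ _ (by simp; norm_num)).mul_left _) fun r hr ↦
    Filter.eventually_atTop.mpr ⟨2 * r, ?_⟩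
  rintro _ h s hs l rfl
  exact weierstrassZeta_bound r hr s hs l h

lemma differentiableOn_weierstrassZeta (L : PeriodPair) :
    DifferentiableOn ℂ (weierstrassZeta L) (L.lattice : Set ℂ)ᶜ := by
  refine (hasSumLocallyUniformly_weierstrassZeta L).hasSumLocallyUniformlyOn.differentiableOn
    (.of_forall fun s ↦ .fun_sum fun i _ ↦ ?_) L.isClosed_lattice.isOpen_compl
  intro x hx
  have : x - i ≠ 0 := fun e ↦ hx (by rw [sub_eq_zero.mp e]; exact i.2)
  refine DifferentiableAt.differentiableWithinAt ?_
  fun_prop (disch := assumption)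

lemma deriv_weierstrassZeta (L : PeriodPair) :
    Set.EqOn (deriv (weierstrassZeta L)) (fun z ↦ -L.weierstrassP z) (L.lattice : Set ℂ)ᶜ := by
  have hne : ∀ x ∈ (L.lattice : Set ℂ)ᶜ, ∀ i : L.lattice, x - i ≠ 0 := fun x hx i e ↦
    hx (by rw [sub_eq_zero.mp e]; exact i.2)
  have hd : ∀ (i : L.lattice), ∀ x ∈ (L.lattice : Set ℂ)ᶜ,
      HasDerivAt (fun z : ℂ ↦ 1 / (z - i) + 1 / (i : ℂ) + z / (i : ℂ) ^ 2)
        (-(1 / (x - i) ^ 2 - 1 / (i : ℂ) ^ 2)) x := by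
    intro i x hx
    have h1 : HasDerivAt (fun z : ℂ ↦ 1 / (z - i)) (-1 / (x - i) ^ 2) x := by
      simpa using ((hasDerivAt_id x).sub_const (i : ℂ)).fun_inv (hne x hx i)
    have h2 : HasDerivAt (fun z : ℂ ↦ z / (i : ℂ) ^ 2) (1 / (i : ℂ) ^ 2) x :=
      (hasDerivAt_id x).div_const _
    exact ((h1.add_const _).add h2).congr_deriv (by ring)
  refine ((hasSumLocallyUniformly_weierstrassZeta L).tendstoLocallyUniformlyOn.deriv
    (.of_forall fun s ↦ ?_) L.isClosed_lattice.isOpen_compl).unique ?_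
  · exact .fun_sum fun i _ x hx ↦ (hd i x hx).differentiableAt.differentiableWithinAt
  · have h := L.hasSumLocallyUniformly_weierstrassP.tendstoLocallyUniformlyOn
      (s := (L.lattice : Set ℂ)ᶜ)
    have h' := uniformContinuous_neg (α := ℂ) |>.comp_tendstoLocallyUniformlyOn h
    refine h'.congr ?_
    intro s x hx
    simp only [Function.comp_apply]
    rw [deriv_fun_sum fun i _ ↦ (hd i x hx).differentiableAt, ← Finset.sum_neg_distrib]
    exact Finset.sum_congr rfl fun i _ ↦ ((hd i x hx).deriv).symm

/-- For a lattice point `l` the difference `ζ(z + l) - ζ(z)` does not depend on `z ∉ L`. -/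
theorem exists_quasiPeriod (L : PeriodPair) (l : L.lattice) :
    ∃ c : ℂ, ∀ z ∉ L.lattice, weierstrassZeta L (z + l) = weierstrassZeta L z + c := by
  have hopen : IsOpen (L.lattice : Set ℂ)ᶜ := L.isClosed_lattice.isOpen_compl
  have hadd : ∀ z ∈ (L.lattice : Set ℂ)ᶜ, z + l ∈ (L.lattice : Set ℂ)ᶜ := fun z hz h ↦
    hz (by simpa using L.lattice.sub_mem h l.2)
  have hdz : ∀ z ∈ (L.lattice : Set ℂ)ᶜ,
      HasDerivAt (weierstrassZeta L) (-L.weierstrassP z) z := fun z hz ↦ by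
    have := ((differentiableOn_weierstrassZeta L).differentiableAt
      (hopen.mem_nhds hz)).hasDerivAt
    rwa [deriv_weierstrassZeta L hz] at this
  have hD : ∀ z ∈ (L.lattice : Set ℂ)ᶜ,
      HasDerivAt (fun z ↦ weierstrassZeta L (z + l) - weierstrassZeta L z) 0 z := fun z hz ↦ by
    refine (((hdz _ (hadd z hz)).comp_add_const z l).sub (hdz z hz)).congr_deriv ?_
    simp
  have hcount : (L.lattice : Set ℂ).Countable :=
    Set.countable_coe_iff.mp (L.latticeEquivProd.toEquiv.countable_iff.mpr inferInstance)
  have hconn := hcount.isConnected_compl_of_one_lt_rank (by simp [Complex.rank_real_complex])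
  obtain ⟨c, hc⟩ := hopen.exists_is_const_of_deriv_eq_zero hconn.isPreconnected
    (fun z hz ↦ (hD z hz).differentiableAt.differentiableWithinAt) (fun z hz ↦ (hD z hz).deriv)
  exact ⟨c, fun z hz ↦ by linear_combination hc z hz⟩

/-- The quasi-period `η(l, L)` of a lattice point `l`. -/
def quasiPeriod (L : PeriodPair) (l : L.lattice) : ℂ := (exists_quasiPeriod L l).choose

/-- The Weierstrass eta function `η(z, L)`, the `ℝ`-linear extension of the quasi-periods. -/
def weierstrassEta (L : PeriodPair) (z : ℂ) : ℂ :=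
  (L.basis.repr z 0 : ℂ) * quasiPeriod L ⟨L.ω₁, L.ω₁_mem_lattice⟩ +
    (L.basis.repr z 1 : ℂ) * quasiPeriod L ⟨L.ω₂, L.ω₂_mem_lattice⟩

open Classical in
/-- `ψ(z, L)` is `-1` if `z ∈ L - 2L` and `1` otherwise. -/
def psi (L : PeriodPair) (z : ℂ) : ℂ :=
  if z ∈ L.lattice ∧ ¬ ∃ l ∈ L.lattice, z = 2 * l then -1 else 1

/-- The lattice `[τ, 1]`. -/
def tauLattice (τ : ℍ) : PeriodPair where
  ω₁ := τ
  ω₂ := 1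
  indep := by
    rw [LinearIndependent.pair_iff]
    intro s t h
    have him := congrArg Complex.im h
    have hs : s = 0 := by simpa [τ.im_ne_zero] using him
    have hre := congrArg Complex.re h
    exact ⟨hs, by simpa [hs] using hre⟩

/-! ### Slash operators -/

/-- `(φ |'_k M)(τ, z) = (c τ + d) ^ (-k) φ ((a τ + b) / (c τ + d), z / (c τ + d))`. -/
def slashM (k : ℤ) (M : SL(2, ℤ)) (φ : ℍ × ℂ → ℂ) : ℍ × ℂ → ℂ := fun p ↦
  ((M 1 0 : ℂ) * p.1 + (M 1 1 : ℂ)) ^ (-k) *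
    φ (M • p.1, p.2 / ((M 1 0 : ℂ) * p.1 + (M 1 1 : ℂ)))

/-- `(φ |''_k (lam, mu))(τ, z) = (ψ(ω) exp (η(ω) (z + ω / 2))) ^ k φ (τ, z + ω)`, where
`ω = lam τ + mu` and `ψ`, `η` are those of the lattice `[τ, 1]`. -/
def slashX (k : ℤ) (lam mu : ℝ) (φ : ℍ × ℂ → ℂ) : ℍ × ℂ → ℂ := fun p ↦
  (psi (tauLattice p.1) (lam * p.1 + mu) *
    Complex.exp (weierstrassEta (tauLattice p.1) (lam * p.1 + mu) *
      (p.2 + (lam * p.1 + mu) / 2))) ^ k *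
    φ (p.1, p.2 + (lam * p.1 + mu))

/-- `ρ(τ, z) = exp (η(1, [τ, 1]) z ^ 2 / 2 - π i z)`. -/
def rho (p : ℍ × ℂ) : ℂ :=
  Complex.exp (weierstrassEta (tauLattice p.1) 1 * p.2 ^ 2 / 2 - Real.pi * Complex.I * p.2)

/-! ### Fourier developments -/

/-- `f` has a Fourier development `∑_{n ≥ 0} ∑_{|r| ≤ r₀(n)} c(n, r) q ^ n ζ ^ r`, where
`q = e(τ)` and `ζ = e(z)`. -/
def HasFourierDevelopment (f : ℍ × ℂ → ℂ) (r₀ : ℕ → ℕ) : Prop :=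
  ∃ c : ℕ → ℤ → ℂ, (∀ n r, (r₀ n : ℤ) < |r| → c n r = 0) ∧
    ∀ (τ : ℍ) (z : ℂ),
      HasSum (fun p : ℕ × ℤ ↦ c p.1 p.2 * Complex.exp (2 * Real.pi * Complex.I * τ) ^ p.1 *
        Complex.exp (2 * Real.pi * Complex.I * z) ^ p.2) (f (τ, z))

/-- An increasing sequence `r₀` of nonnegative integers with `r₀(n) / n → 0`. -/
def IsSlow (r₀ : ℕ → ℕ) : Prop :=
  Monotone r₀ ∧ Tendsto (fun n : ℕ ↦ (r₀ n : ℝ) / n) atTop (𝓝 0)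

lemma IsSlow.zero : IsSlow (fun _ ↦ 0) := ⟨monotone_const, by simp⟩

lemma IsSlow.max {r s : ℕ → ℕ} (hr : IsSlow r) (hs : IsSlow s) :
    IsSlow (fun n ↦ Max.max (r n) (s n)) := by
  refine ⟨hr.1.max hs.1, ?_⟩
  have := hr.2.max hs.2
  rw [max_self] at this
  refine this.congr fun n ↦ ?_
  rw [Nat.cast_max, max_div_div_right (Nat.cast_nonneg n)]

lemma HasFourierDevelopment.zero (r₀ : ℕ → ℕ) : HasFourierDevelopment 0 r₀ :=
  ⟨0, by simp, fun τ z ↦ by simp⟩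

lemma HasFourierDevelopment.add {f g : ℍ × ℂ → ℂ} {r s : ℕ → ℕ}
    (hf : HasFourierDevelopment f r) (hg : HasFourierDevelopment g s) :
    HasFourierDevelopment (f + g) (fun n ↦ Max.max (r n) (s n)) := by
  obtain ⟨c, hc, hc'⟩ := hf
  obtain ⟨d, hd, hd'⟩ := hg
  refine ⟨c + d, fun n t h ↦ ?_, fun τ z ↦ ?_⟩
  · rw [Nat.cast_max, max_lt_iff] at h
    simp [hc n t h.1, hd n t h.2]
  · simpa [add_mul] using (hc' τ z).add (hd' τ z)

lemma HasFourierDevelopment.smul {f : ℍ × ℂ → ℂ} {r : ℕ → ℕ} (a : ℂ)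
    (hf : HasFourierDevelopment f r) : HasFourierDevelopment (a • f) r := by
  obtain ⟨c, hc, hc'⟩ := hf
  refine ⟨a • c, fun n t h ↦ by simp [hc n t h], fun τ z ↦ ?_⟩
  simpa [mul_assoc] using (hc' τ z).mul_left a

lemma slashM_zero (k : ℤ) (M : SL(2, ℤ)) : slashM k M 0 = 0 := by
  ext; simp [slashM]

lemma slashM_add (k : ℤ) (M : SL(2, ℤ)) (f g : ℍ × ℂ → ℂ) :
    slashM k M (f + g) = slashM k M f + slashM k M g := by
  ext; simp [slashM, mul_add]

lemma slashM_smul (k : ℤ) (M : SL(2, ℤ)) (a : ℂ) (f : ℍ × ℂ → ℂ) :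
    slashM k M (a • f) = a • slashM k M f := by
  ext; simp [slashM, mul_left_comm]

lemma slashX_zero (k : ℤ) (lam mu : ℝ) : slashX k lam mu 0 = 0 := by
  ext; simp [slashX]

lemma slashX_add (k : ℤ) (lam mu : ℝ) (f g : ℍ × ℂ → ℂ) :
    slashX k lam mu (f + g) = slashX k lam mu f + slashX k lam mu g := by
  ext; simp [slashX, mul_add]

lemma slashX_smul (k : ℤ) (lam mu : ℝ) (a : ℂ) (f : ℍ × ℂ → ℂ) :
    slashX k lam mu (a • f) = a • slashX k lam mu f := by
  ext; simp [slashX, mul_left_comm]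

/-! ### Modified Jacobi forms of index zero -/

/-- Holomorphy of a function on `ℍ × ℂ`. -/
def IsHolomorphic (φ : ℍ × ℂ → ℂ) : Prop :=
  DifferentiableOn ℂ (fun p : ℂ × ℂ ↦ φ (ofComplex p.1, p.2)) {p | 0 < p.1.im}

/-- A modified Jacobi form of weight `k` and index `0` on `Γ`. -/
structure IsModifiedJacobiForm (k : ℤ) (Γ : Subgroup SL(2, ℤ)) (φ : ℍ × ℂ → ℂ) : Prop where
  holomorphic : IsHolomorphic φ
  slashM_eq : ∀ M ∈ Γ, slashM k M φ = φ
  slashX_eq : ∀ lam mu : ℤ, slashX k lam mu φ = φ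
  fourier : ∀ M : SL(2, ℤ), ∃ r₀ : ℕ → ℕ, IsSlow r₀ ∧
    HasFourierDevelopment (fun p ↦ rho p ^ k * slashM k M φ p) r₀

/-- The complex vector space `J_k(Γ)`. -/
def J (k : ℤ) (Γ : Subgroup SL(2, ℤ)) : Submodule ℂ (ℍ × ℂ → ℂ) where
  carrier := {φ | IsModifiedJacobiForm k Γ φ}
  zero_mem' := by
    refine ⟨differentiableOn_const 0, fun M _ ↦ slashM_zero k M, fun _ _ ↦ slashX_zero k _ _,
      fun M ↦ ⟨_, IsSlow.zero, ?_⟩⟩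
    convert! HasFourierDevelopment.zero _ using 1
    ext; simp [slashM_zero]
  add_mem' := by
    intro f g hf hg
    refine ⟨hf.1.add hg.1, fun M hM ↦ ?_, fun l m ↦ ?_, fun M ↦ ?_⟩
    · rw [slashM_add, hf.2 M hM, hg.2 M hM]
    · rw [slashX_add, hf.3, hg.3]
    · obtain ⟨r, hr, hr'⟩ := hf.4 M
      obtain ⟨s, hs, hs'⟩ := hg.4 M
      refine ⟨_, hr.max hs, ?_⟩
      convert! hr'.add hs' using 1
      ext; simp [slashM_add, mul_add]
  smul_mem' := by
    intro a f hf
    refine ⟨hf.1.const_smul a, fun M hM ↦ ?_, fun l m ↦ ?_, fun M ↦ ?_⟩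
    · rw [slashM_smul, hf.2 M hM]
    · rw [slashX_smul, hf.3]
    · obtain ⟨r, hr, hr'⟩ := hf.4 M
      refine ⟨r, hr, ?_⟩
      convert! hr'.smul a using 1
      ext; simp [slashM_smul, mul_left_comm]

/-- `ρ ^ k φ` has a Fourier development as in the definition of a modified Jacobi form, with
`min {n - r₀(n) : n ≥ 0} + k / 8 ≥ -m`. -/
def HasBoundedFourier (k m : ℤ) (φ : ℍ × ℂ → ℂ) : Prop :=
  ∃ r₀ : ℕ → ℕ, IsSlow r₀ ∧ HasFourierDevelopment (fun p ↦ rho p ^ k * φ p) r₀ ∧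
    ∃ μ : ℤ, IsLeast (Set.range fun n : ℕ ↦ (n : ℤ) - (r₀ n : ℤ)) μ ∧
      -(m : ℝ) ≤ (μ : ℝ) + (k : ℝ) / 8

lemma HasBoundedFourier.add {k m : ℤ} {f g : ℍ × ℂ → ℂ} (hf : HasBoundedFourier k m f)
    (hg : HasBoundedFourier k m g) : HasBoundedFourier k m (f + g) := by
  obtain ⟨r, hr, hfr, μ, ⟨⟨a, ha⟩, hμ⟩, hμm⟩ := hf
  obtain ⟨s, hs, hgs, ν, ⟨⟨b, hb⟩, hν⟩, hνm⟩ := hg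
  have h1 : ∀ n : ℕ, μ ≤ (n : ℤ) - r n := fun n ↦ hμ ⟨n, rfl⟩
  have h2 : ∀ n : ℕ, ν ≤ (n : ℤ) - s n := fun n ↦ hν ⟨n, rfl⟩
  refine ⟨_, hr.max hs, ?_, min μ ν, ⟨?_, ?_⟩, ?_⟩
  · convert! hfr.add hgs using 1
    ext; simp [mul_add]
  · rcases le_total μ ν with h | h
    · refine ⟨a, ?_⟩
      have := h2 a
      simp only at ha ⊢
      omega
    · refine ⟨b, ?_⟩
      have := h1 b
      simp only at hb ⊢
      omega
  · rintro _ ⟨n, rfl⟩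
    have := h1 n
    have := h2 n
    simp only
    omega
  · rcases min_choice μ ν with h | h <;> rw [h] <;> assumption

lemma HasBoundedFourier.smul {k m : ℤ} {f : ℍ × ℂ → ℂ} (a : ℂ)
    (hf : HasBoundedFourier k m f) : HasBoundedFourier k m (a • f) := by
  obtain ⟨r, hr, hfr, hμ⟩ := hf
  refine ⟨r, hr, ?_, hμ⟩
  convert! hfr.smul a using 1
  ext; simp [mul_left_comm]

/-- The subspace `J_k^m` of `J_k(SL₂(ℤ))`. The zero form is included by convention: since
`n - r₀(n) ≤ 0` for `n = 0`, no form at all satisfies the inequality when `k < -8 m`, and when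
`-8 m ≤ k` the zero form satisfies it with `r₀ = 0`. -/
def Jm (k m : ℤ) : Submodule ℂ (ℍ × ℂ → ℂ) where
  carrier := {φ | φ ∈ J k ⊤ ∧ (φ = 0 ∨ HasBoundedFourier k m φ)}
  zero_mem' := ⟨(J k ⊤).zero_mem, Or.inl rfl⟩
  add_mem' := by
    rintro f g ⟨hf, hf'⟩ ⟨hg, hg'⟩
    refine ⟨(J k ⊤).add_mem hf hg, ?_⟩
    rcases hf' with rfl | hf'
    · simpa using hg'
    · rcases hg' with rfl | hg'
      · right
        simpa using hf'
      · exact Or.inr (hf'.add hg')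
  smul_mem' := by
    rintro a f ⟨hf, hf'⟩
    refine ⟨(J k ⊤).smul_mem a hf, ?_⟩
    rcases hf' with rfl | hf'
    · left
      simp
    · exact Or.inr (hf'.smul a)

end ModifiedJacobi

end

/-!
Fix a form `φ` of weight `k = -N ≤ 0` and expand `ρ ^ k φ = ∑ c(n, r) qⁿ ζʳ`. The Legendre relation
turns the invariance of `φ` under `z ↦ z + τ` into the shift symmetry
`c(n, r) = (-1) ^ k c(n + r, r + N)`. The first nonzero coefficient in the Taylor expansion of `φ`
at `z = 0`, say that of `zʲ`, is a modular form of level one and weight `k + j`, so it vanishes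
for `j < N` and is a constant for `j = N`. If that constant is zero too, then the moments
`∑ r, c(n, r) rʲ` with `j ≤ N` all vanish. By the shift symmetry the lowest nonzero row of `c` is
supported on the `N + 1` integers `0 ≤ r ≤ N`, so a Vandermonde determinant shows that there is no
such row. Hence `φ` is determined by one complex number.
-/

noncomputable section

namespace ModifiedJacobi

open Filter Topology UpperHalfPlane
open scoped MatrixGroups Manifold ModularForm Real

local notation "𝐞(" x ")" => Complex.exp (2 * Real.pi * Complex.I * x)

/-! ### The Legendre relation -/

section Cotangent

open Complex (cot integerComplement)

lemma summable_one_div_sub_sub_one_div_sub {w w' : ℂ} (hw : w ∈ integerComplement)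
    (hw' : w' ∈ integerComplement) : Summable fun m : ℤ ↦ 1 / (w' - m) - 1 / (w - m) := by
  have hO : ∀ x : ℂ, (fun m : ℤ ↦ (x - m)⁻¹) =O[cofinite] fun m ↦ (m : ℝ)⁻¹ := fun x ↦ by
    refine (EisensteinSeries.linear_inv_isBigO_right 1 (-x)).neg_left.congr_left fun m ↦ ?_
    rw [← inv_neg, Int.cast_one, one_mul, neg_add, neg_neg, sub_eq_add_neg]
  have hprod : Summable fun m : ℤ ↦ ((w' - m) * (w - m))⁻¹ :=
    EisensteinSeries.summable_inv_of_isBigO_rpow_inv one_lt_two (by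
      simpa only [Real.rpow_two, pow_two, abs_mul_abs_self, mul_inv] using! (hO w').mul (hO w))
  refine (hprod.mul_left (w - w')).congr fun m ↦ ?_
  have hm : w - m ≠ 0 := sub_ne_zero.mpr fun h ↦ hw ⟨m, h.symm⟩
  have hm' : w' - m ≠ 0 := sub_ne_zero.mpr fun h ↦ hw' ⟨m, h.symm⟩
  field_simp
  ring

lemma hasSum_one_div_sub_sub_one_div_sub {w w' : ℂ} (hw : w ∈ integerComplement)
    (hw' : w' ∈ integerComplement) :
    HasSum (fun m : ℤ ↦ 1 / (w' - m) - 1 / (w - m))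
      (π * cot (π * w') - π * cot (π * w)) := by
  have hs := summable_one_div_sub_sub_one_div_sub hw hw'
  have hpairs := hs.hasSum.nat_add_neg
  have hcot : ∀ {x : ℂ}, x ∈ integerComplement → HasSum
      (fun n : ℕ ↦ 1 / (x - (n + 1)) + 1 / (x + (n + 1))) (π * cot (π * x) - 1 / x) :=
    fun hx ↦ cot_series_rep' hx ▸ (summable_cotTerm hx).hasSum
  have hdiff := (hcot hw').sub (hcot hw)
  rw [← hasSum_nat_add_iff' 1] at hpairs
  have := hdiff.unique (hpairs.congr_fun fun n ↦ by push_cast; ring_nf)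
  convert! hs.hasSum using 1
  simp only [Finset.range_one, Finset.sum_singleton, Nat.cast_zero, neg_zero, Int.cast_zero,
    sub_zero] at this
  linear_combination this

lemma cot_pi_mul_add_one (w : ℂ) : cot (π * (w + 1)) = cot (π * w) := by
  simp only [mul_add, mul_one, Complex.cot, Complex.cos_add_pi, Complex.sin_add_pi, neg_div_neg_eq]

lemma tendsto_cot_pi_comap_im_atTop :
    Tendsto (fun w ↦ cot (π * w)) (comap Complex.im atTop) (𝓝 (-Complex.I)) := by
  have hq : Tendsto (fun w : ℂ ↦ 𝐞(w)) (comap Complex.im atTop) (𝓝 0) := by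
    have := tendsto_nhds_of_tendsto_nhdsWithin (Function.Periodic.qParam_tendsto one_pos)
    refine this.congr fun w ↦ ?_
    rw [Function.Periodic.qParam, Complex.ofReal_one, div_one]
  have := (hq.add_const 1).div ((hq.const_sub 1).const_mul Complex.I) (by simp)
  simpa [Complex.cot_pi_eq_exp_ratio] using! this

lemma tendsto_cot_pi_comap_im_atBot :
    Tendsto (fun w ↦ cot (π * w)) (comap Complex.im atBot) (𝓝 Complex.I) := by
  have hneg : Tendsto (fun w : ℂ ↦ -w) (comap Complex.im atBot) (comap Complex.im atTop) :=
    tendsto_comap_iff.mpr (tendsto_neg_atBot_atTop.comp tendsto_comap)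
  refine (neg_neg Complex.I ▸ (tendsto_cot_pi_comap_im_atTop.comp hneg).neg).congr fun w ↦ ?_
  simp only [Function.comp_apply, mul_neg, Complex.cot, Complex.cos_neg, Complex.sin_neg, div_neg,
    neg_neg]

end Cotangent

lemma eq_sub_of_hasSum_sub {G : Type*} [AddCommGroup G] [TopologicalSpace G]
    [IsTopologicalAddGroup G] [T2Space G] {b : ℤ → G} {s x y : G}
    (hx : Tendsto b atTop (𝓝 x)) (hy : Tendsto b atBot (𝓝 y))
    (hb : HasSum (fun n ↦ b (n + 1) - b n) s) : s = x - y := by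
  have hpartial := hb.nat_add_neg_add_one.tendsto_sum_nat
  have hsymm : ∀ K : ℕ, ∑ n ∈ Finset.range K, ((b (n + 1) - b n) +
      (b (-(n + 1) + 1) - b (-(n + 1)))) = b K - b (-K) := fun K ↦ by
    have := Finset.sum_range_sub (fun n : ℕ ↦ b n - b (-n)) K
    simp only [Nat.cast_zero, neg_zero, sub_self, sub_zero] at this
    rw [← this]
    refine Finset.sum_congr rfl fun n _ ↦ ?_
    rw [show -((n : ℤ) + 1) + 1 = -n by ring]
    push_cast
    abel
  simp only [hsymm] at hpartial
  exact tendsto_nhds_unique hpartial ((hx.comp tendsto_natCast_atTop_atTop).sub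
    (hy.comp (tendsto_neg_atTop_atBot.comp tendsto_natCast_atTop_atTop)))

lemma weierstrassZeta_add (L : PeriodPair) (l : L.lattice) {z : ℂ} (hz : z ∉ L.lattice) :
    weierstrassZeta L (z + l) = weierstrassZeta L z + quasiPeriod L l :=
  (exists_quasiPeriod L l).choose_spec z hz

lemma hasSum_quasiPeriod (L : PeriodPair) (l : L.lattice) {z : ℂ} (hz : z ∉ L.lattice) :
    HasSum (fun ω : L.lattice ↦ 1 / (z + l - ω) - 1 / (z - ω) + l / (ω : ℂ) ^ 2)
      (quasiPeriod L l) := by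
  have hζ := hasSumLocallyUniformly_weierstrassZeta L
  have h := (hζ.hasSum (x := z + l)).sub (hζ.hasSum (x := z))
  rw [weierstrassZeta_add L l hz, add_sub_cancel_left] at h
  exact h.congr_fun fun ω ↦ by ring

lemma hasSum_mul_quasiPeriod_sub (L : PeriodPair) (l l' : L.lattice) {z : ℂ}
    (hz : z ∉ L.lattice) :
    HasSum (fun ω : L.lattice ↦ l' * (1 / (z + l - ω) - 1 / (z - ω)) -
      l * (1 / (z + l' - ω) - 1 / (z - ω))) (l' * quasiPeriod L l - l * quasiPeriod L l') :=
  (((hasSum_quasiPeriod L l hz).mul_left (l' : ℂ)).sub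
    ((hasSum_quasiPeriod L l' hz).mul_left (l : ℂ))).congr_fun fun ω ↦ by ring

lemma weierstrassEta_ω₁ (L : PeriodPair) :
    weierstrassEta L L.ω₁ = quasiPeriod L ⟨L.ω₁, L.ω₁_mem_lattice⟩ := by
  have h : L.basis.repr L.ω₁ = Finsupp.single 0 1 := by
    rw [← L.basis_zero, Module.Basis.repr_self]
  simp [weierstrassEta, h]

lemma weierstrassEta_ω₂ (L : PeriodPair) :
    weierstrassEta L L.ω₂ = quasiPeriod L ⟨L.ω₂, L.ω₂_mem_lattice⟩ := by
  have h : L.basis.repr L.ω₂ = Finsupp.single 1 1 := by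
    rw [← L.basis_one, Module.Basis.repr_self]
  simp [weierstrassEta, h]

lemma psi_ω₁ (L : PeriodPair) : psi L L.ω₁ = -1 := by
  refine if_pos ⟨L.ω₁_mem_lattice, fun ⟨l, hl, hω⟩ ↦ L.ω₁_div_two_notMem_lattice ?_⟩
  rwa [hω, mul_div_cancel_left₀ l two_ne_zero]

section Legendre

variable (τ : ℍ)

lemma half_notMem_lattice : (τ / 2 : ℂ) ∉ (tauLattice τ).lattice :=
  (tauLattice τ).ω₁_div_two_notMem_lattice

lemma half_sub_mem_integerComplement (n : ℤ) :
    (τ / 2 - n * τ : ℂ) ∈ Complex.integerComplement := by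
  rintro ⟨m, hm⟩
  refine half_notMem_lattice τ (PeriodPair.mem_lattice.mpr ⟨n, m, ?_⟩)
  simp only [tauLattice, mul_one, hm, add_sub_cancel]

lemma hasSum_cot_rows :
    HasSum (fun n : ℤ ↦ π * Complex.cot (π * (τ / 2 - (n - 1) * τ)) -
      π * Complex.cot (π * (τ / 2 - n * τ)))
      (weierstrassEta (tauLattice τ) τ - τ * weierstrassEta (tauLattice τ) 1) := by
  set L := tauLattice τ
  have hη : HasSum (fun p : ℤ × ℤ ↦
      (1 / (τ / 2 - (p.1 - 1) * τ - p.2) - 1 / (τ / 2 - p.1 * τ - p.2) : ℂ) -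
        τ * (1 / (τ / 2 - p.1 * τ + 1 - p.2) - 1 / (τ / 2 - p.1 * τ - p.2)))
      (weierstrassEta L τ - τ * weierstrassEta L 1) := by
    have h := hasSum_mul_quasiPeriod_sub L ⟨L.ω₁, L.ω₁_mem_lattice⟩ ⟨L.ω₂, L.ω₂_mem_lattice⟩
      (half_notMem_lattice τ)
    rw [← weierstrassEta_ω₁, ← weierstrassEta_ω₂] at h
    have h' := L.latticeEquivProd.symm.toEquiv.hasSum_iff.mpr h
    simp only [Function.comp_def, LinearEquiv.coe_toEquiv, L.latticeEquiv_symm_apply] at h'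
    convert! h' using 1
    · ext p
      simp only [L, tauLattice]
      ring_nf
    · simp [L, tauLattice]
  refine hη.prod_fiberwise fun n ↦ ?_
  have hn := half_sub_mem_integerComplement τ n
  have hn₁ := half_sub_mem_integerComplement τ (n - 1)
  have hn' : (τ / 2 - n * τ + 1 : ℂ) ∈ Complex.integerComplement :=
    mod_cast (Complex.add_intCast_mem_integerComplement 1).mpr hn
  have h₁ := (hasSum_one_div_sub_sub_one_div_sub hn (by simpa using hn₁))
  have h₂ := (hasSum_one_div_sub_sub_one_div_sub hn hn').mul_left (τ : ℂ)
  rw [cot_pi_mul_add_one, sub_self, mul_zero] at h₂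
  simpa using h₁.sub h₂

lemma im_half_sub_mul (n : ℤ) : (τ / 2 - (n - 1) * τ : ℂ).im = (3 / 2 + -n : ℝ) * τ.im := by
  simp
  ring

lemma tendsto_half_sub_mul_atTop :
    Tendsto (fun n : ℤ ↦ (τ / 2 - (n - 1) * τ : ℂ)) atTop (comap Complex.im atBot) := by
  simp only [tendsto_comap_iff, Function.comp_def, im_half_sub_mul]
  exact (tendsto_atBot_add_const_left _ _ (tendsto_neg_atTop_atBot.comp
    tendsto_intCast_atTop_atTop)).atBot_mul_const τ.im_pos

lemma tendsto_half_sub_mul_atBot :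
    Tendsto (fun n : ℤ ↦ (τ / 2 - (n - 1) * τ : ℂ)) atBot (comap Complex.im atTop) := by
  simp only [tendsto_comap_iff, Function.comp_def, im_half_sub_mul]
  exact (tendsto_atTop_add_const_left _ _ (tendsto_neg_atBot_atTop.comp
    (tendsto_intCast_atBot_iff.mpr tendsto_id))).atTop_mul_const τ.im_pos

theorem legendre_relation :
    weierstrassEta (tauLattice τ) τ = τ * weierstrassEta (tauLattice τ) 1 - 2 * π * Complex.I := by
  have hrows : HasSum (fun n : ℤ ↦ -(π * Complex.cot (π * (τ / 2 - ((n + 1 : ℤ) - 1) * τ))) -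
      -(π * Complex.cot (π * (τ / 2 - (n - 1) * τ))))
      (weierstrassEta (tauLattice τ) τ - τ * weierstrassEta (tauLattice τ) 1) :=
    (hasSum_cot_rows τ).congr_fun fun n ↦ by
      push_cast
      ring_nf
  have hbot : Tendsto (fun n : ℤ ↦ -(π * Complex.cot (π * (τ / 2 - (n - 1) * τ)))) atTop
      (𝓝 (-(π * Complex.I))) :=
    ((tendsto_cot_pi_comap_im_atBot.comp (tendsto_half_sub_mul_atTop τ)).const_mul (π : ℂ)).neg
  have htop : Tendsto (fun n : ℤ ↦ -(π * Complex.cot (π * (τ / 2 - (n - 1) * τ)))) atBot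
      (𝓝 (-(π * -Complex.I))) :=
    ((tendsto_cot_pi_comap_im_atTop.comp (tendsto_half_sub_mul_atBot τ)).const_mul (π : ℂ)).neg
  have hη := eq_sub_of_hasSum_sub hbot htop hrows
  linear_combination hη

end Legendre

lemma rho_ne_zero (p : ℍ × ℂ) : rho p ≠ 0 := Complex.exp_ne_zero _

lemma rho_zpow_mul_add_tau {k : ℤ} {φ : ℍ × ℂ → ℂ} (hφ : slashX k 1 0 φ = φ) (τ : ℍ) (z : ℂ) :
    rho (τ, z + τ) ^ k * φ (τ, z + τ) = (-𝐞(z)) ^ k * (rho (τ, z) ^ k * φ (τ, z)) := by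
  have hψ : psi (tauLattice τ) τ = -1 := psi_ω₁ (tauLattice τ)
  have hshift := congrFun hφ (τ, z)
  simp only [slashX, Complex.ofReal_one, one_mul, Complex.ofReal_zero, add_zero, hψ] at hshift
  have hrho : rho (τ, z + τ) = -𝐞(z) * rho (τ, z) *
      (-1 * Complex.exp (weierstrassEta (tauLattice τ) τ * (z + τ / 2))) := by
    simp only [rho, neg_mul, mul_neg, neg_neg, one_mul, ← Complex.exp_add, legendre_relation τ]
    ring_nf
  rw [← hshift, hrho, mul_zpow, mul_zpow, mul_assoc, mul_assoc]

/-! ### Fourier coefficients -/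

/-- `f` is the sum of the Fourier series `∑ c(n, r) qⁿ ζʳ` at every point of `ℍ × ℂ`. Unlike in
`HasFourierDevelopment`, the coefficients are given and their support is not restricted. -/
def IsFourierDevelopment (c : ℕ → ℤ → ℂ) (f : ℍ × ℂ → ℂ) : Prop :=
  ∀ (τ : ℍ) (z : ℂ), HasSum (fun p : ℕ × ℤ ↦ c p.1 p.2 * 𝐞(τ) ^ p.1 * 𝐞(z) ^ p.2) (f (τ, z))

lemma eq_zero_of_hasSum_fourier {T : ℝ} [Fact (0 < T)] {a : ℤ → ℂ}
    (h : ∀ x : AddCircle T, HasSum (fun r ↦ a r * fourier r x) 0) : a = 0 := by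
  have hsummable : Summable fun r ↦ a r • fourier (T := T) r :=
    .of_norm <| by simpa [norm_smul, fourier_norm] using (h 0).summable.norm
  have hsum : HasSum (fun r ↦ a r • fourier (T := T) r) 0 := by
    convert! hsummable.hasSum
    ext x
    exact (h x).tsum_eq.symm.trans (ContinuousMap.tsum_apply hsummable x)
  ext s
  have hcoeff := ((innerSL ℂ (fourierLp 2 s)).comp
    (ContinuousMap.toLp 2 AddCircle.haarAddCircle ℂ)).hasSum hsum
  rw [map_zero] at hcoeff
  refine HasSum.unique ?_ hcoeff
  refine (hasSum_ite_eq s (a s)).congr_fun fun r ↦ ?_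
  have horth := orthonormal_iff_ite.mp (orthonormal_fourier (T := T)) s r
  simp only [map_smul, ContinuousLinearMap.comp_apply, innerSL_apply_apply,
    horth, smul_eq_mul, mul_ite, mul_one, mul_zero, eq_comm (a := s)]
  split_ifs with hr
  · rw [hr]
  · rfl

lemma eq_zero_of_hasSum_exp_zpow {a : ℤ → ℂ} (h : ∀ x : ℝ, HasSum (fun r ↦ a r * 𝐞(x) ^ r) 0) :
    a = 0 := by
  refine eq_zero_of_hasSum_fourier (T := 1) fun x ↦ ?_
  obtain ⟨x, rfl⟩ := QuotientAddGroup.mk_surjective x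
  refine (h x).congr_fun fun r ↦ ?_
  rw [← Complex.exp_int_mul, fourier_coe_apply, Complex.ofReal_one, div_one]
  ring_nf

lemma hasSum_zero_of_hasSum_exp_zpow {ι : Type*} {A : ι × ℤ → ℂ}
    (h : ∀ x : ℝ, HasSum (fun p ↦ A p * 𝐞(x) ^ p.2) 0) (r : ℤ) :
    HasSum (fun i ↦ A (i, r)) 0 := by
  have hswap : ∀ x : ℝ, HasSum (fun p : ℤ × ι ↦ A p.swap * 𝐞(x) ^ p.1) 0 := fun x ↦
    (Equiv.prodComm ℤ ι).hasSum_iff.mpr (h x)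
  have hcol : ∀ r, Summable fun i ↦ A (i, r) := fun r ↦ by
    simpa using (hswap 0).summable.prod_factor r
  have hzero : (fun r ↦ ∑' i, A (i, r)) = 0 := eq_zero_of_hasSum_exp_zpow fun x ↦
    (hswap x).prod_fiberwise fun r ↦ (hcol r).hasSum.mul_right (𝐞(x) ^ r)
  have hr : ∑' i, A (i, r) = 0 := congrFun hzero r
  exact hr ▸ (hcol r).hasSum

lemma eq_zero_of_hasSum_exp_zpow_mul_exp_zpow {D : ℤ × ℤ → ℂ}
    (h : ∀ (τ : ℍ) (z : ℂ), HasSum (fun p : ℤ × ℤ ↦ D p * 𝐞(τ) ^ p.1 * 𝐞(z) ^ p.2) 0) :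
    D = 0 := by
  have hcol : ∀ (r : ℤ) (τ : ℍ), HasSum (fun n ↦ D (n, r) * 𝐞(τ) ^ n) 0 := fun r τ ↦
    hasSum_zero_of_hasSum_exp_zpow (fun x ↦ h τ x) r
  ext ⟨n, r⟩
  have hzero : (fun n ↦ D (n, r) * 𝐞(I) ^ n) = 0 := eq_zero_of_hasSum_exp_zpow fun x ↦
    (hcol r (x +ᵥ I)).congr_fun fun n ↦ by
      rw [coe_vadd, mul_add, Complex.exp_add, mul_zpow]
      ring
  simpa [Complex.exp_ne_zero, zpow_ne_zero] using congrFun hzero n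

/-- The coefficients `c` extended by zero to negative powers of `q`, so that the shift
`(n, r) ↦ (n + r, r - k)` of exponents makes sense. -/
def extendCoeff (c : ℕ → ℤ → ℂ) (p : ℤ × ℤ) : ℂ := if 0 ≤ p.1 then c p.1.toNat p.2 else 0

lemma extendCoeff_natCast (c : ℕ → ℤ → ℂ) (n : ℕ) (r : ℤ) : extendCoeff c (n, r) = c n r := by
  simp [extendCoeff]

lemma extendCoeff_of_neg (c : ℕ → ℤ → ℂ) {n : ℤ} (hn : n < 0) (r : ℤ) :
    extendCoeff c (n, r) = 0 := if_neg hn.not_ge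

lemma IsFourierDevelopment.hasSum_extendCoeff {c : ℕ → ℤ → ℂ} {f : ℍ × ℂ → ℂ}
    (h : IsFourierDevelopment c f) (τ : ℍ) (z : ℂ) :
    HasSum (fun p : ℤ × ℤ ↦ extendCoeff c p * 𝐞(τ) ^ p.1 * 𝐞(z) ^ p.2) (f (τ, z)) := by
  have hinj : Function.Injective (Prod.map ((↑) : ℕ → ℤ) (id : ℤ → ℤ)) :=
    Nat.cast_injective.prodMap Function.injective_id
  refine (hinj.hasSum_iff ?_).mp ((h τ z).congr_fun fun p ↦ ?_)
  · rintro ⟨n, r⟩ hp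
    have hn : n < 0 := by
      by_contra! hn
      exact hp ⟨(n.toNat, r), by simp [hn]⟩
    rw [extendCoeff_of_neg c hn, zero_mul, zero_mul]
  · obtain ⟨n, r⟩ := p
    simp only [Function.comp_apply, Prod.map_apply, id, zpow_natCast, extendCoeff_natCast]

lemma IsFourierDevelopment.hasSum_shift {c : ℕ → ℤ → ℂ} {f : ℍ × ℂ → ℂ} {k : ℤ}
    (hc : IsFourierDevelopment c f)
    (hf : ∀ (τ : ℍ) (z : ℂ), f (τ, z + τ) = (-𝐞(z)) ^ k * f (τ, z)) (τ : ℍ) (z : ℂ) :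
    HasSum (fun p : ℤ × ℤ ↦ extendCoeff c p * 𝐞(τ) ^ (p.1 + p.2) * 𝐞(z) ^ (p.2 - k))
      ((-1) ^ k * f (τ, z)) := by
  have hζ : 𝐞(z) ≠ 0 := Complex.exp_ne_zero _
  have hval : 𝐞(z) ^ (-k) * f (τ, z + τ) = (-1) ^ k * f (τ, z) := by
    rw [hf, neg_eq_neg_one_mul 𝐞(z), mul_zpow, zpow_neg]
    field_simp
  rw [← hval]
  refine ((hc.hasSum_extendCoeff τ (z + τ)).mul_left (𝐞(z) ^ (-k))).congr_fun fun p ↦ ?_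
  simp only [mul_add, Complex.exp_add, mul_zpow, sub_eq_add_neg, zpow_add₀ hζ,
    zpow_add₀ (Complex.exp_ne_zero (2 * π * Complex.I * τ))]
  ring

lemma IsFourierDevelopment.extendCoeff_eq {c : ℕ → ℤ → ℂ} {f : ℍ × ℂ → ℂ} {k : ℤ}
    (hc : IsFourierDevelopment c f)
    (hf : ∀ (τ : ℍ) (z : ℂ), f (τ, z + τ) = (-𝐞(z)) ^ k * f (τ, z)) (n r : ℤ) :
    extendCoeff c (n, r) = (-1) ^ k * extendCoeff c (n + r, r - k) := by
  let e : ℤ × ℤ ≃ ℤ × ℤ :=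
    { toFun := fun p ↦ (p.1 + p.2, p.2 - k)
      invFun := fun p ↦ (p.1 - (p.2 + k), p.2 + k)
      left_inv := fun p ↦ by ext <;> simp
      right_inv := fun p ↦ by ext <;> simp }
  have hunique : (fun p ↦ extendCoeff c (e.symm p) - (-1) ^ k * extendCoeff c p) = 0 := by
    refine eq_zero_of_hasSum_exp_zpow_mul_exp_zpow fun τ z ↦ ?_
    have hdiff := (e.symm.hasSum_iff.mpr (hc.hasSum_shift hf τ z)).sub
      ((hc.hasSum_extendCoeff τ z).mul_left ((-1) ^ k))
    rw [sub_self] at hdiff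
    refine hdiff.congr_fun fun p ↦ ?_
    simp only [e, Function.comp_apply, Equiv.coe_fn_symm_mk, sub_add_cancel, add_sub_cancel_right]
    ring
  simpa [e, sub_eq_zero] using congrFun hunique (e (n, r))

/-! ### Power series in `q` -/

lemma differentiableOn_tsum_mul_pow {a : ℕ → ℂ} {R : ℝ} (h : Summable fun n ↦ ‖a n‖ * R ^ n) :
    DifferentiableOn ℂ (fun w ↦ ∑' n, a n * w ^ n) (Metric.ball 0 R) := by
  refine Complex.differentiableOn_tsum_of_summable_norm h (fun n ↦ by fun_prop)
    Metric.isOpen_ball fun n w hw ↦ ?_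
  have hw' : ‖w‖ ≤ R := (mem_ball_zero_iff.mp hw).le
  rw [norm_mul, norm_pow]
  gcongr

/-- `f` is the sum of the power series `∑ a n qⁿ` on `ℍ`. In contrast to Mathlib's `qExpansion`,
this assumes nothing about `f` and records convergence. -/
def IsQExpansion (a : ℕ → ℂ) (f : ℍ → ℂ) : Prop :=
  ∀ τ : ℍ, HasSum (fun n ↦ a n * 𝐞(τ) ^ n) (f τ)

namespace IsQExpansion

variable {a : ℕ → ℂ} {f : ℍ → ℂ}

lemma hasSum_qParam (h : IsQExpansion a f) (τ : ℍ) :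
    HasSum (fun n ↦ a n • Function.Periodic.qParam 1 τ ^ n) (f τ) := by
  simpa [Function.Periodic.qParam] using h τ

lemma eq_zero (h : IsQExpansion a 0) : a = 0 := by
  ext n
  rw [ModularFormClass.qExpansion_coeff_unique (f := (0 : ModularForm 𝒮ℒ 0)) one_pos
    one_mem_strictPeriods_SL h.hasSum_qParam n, FunLike.coe_zero, qExpansion_zero]
  rfl

lemma isBoundedAtImInfty (h : IsQExpansion a f) : IsBoundedAtImInfty f :=
  isBoundedAtImInfty_of_hasSum_qExpansion one_pos h.hasSum_qParam

lemma mdifferentiable (h : IsQExpansion a f) : MDiff f := by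
  refine UpperHalfPlane.mdifferentiable_iff.mpr fun w hw ↦ ?_
  have hw : 0 < w.im := hw
  have hhalf : 0 < (w / 2).im := by simpa using hw
  have hball : 𝐞(w) ∈ Metric.ball 0 ‖𝐞(w / 2)‖ := by
    suffices 2 * π * (w.im / 2) < 2 * π * w.im by simpa [Complex.norm_exp] using this
    gcongr
    exact half_lt_self hw
  have hsum : Summable fun n ↦ ‖a n‖ * ‖𝐞(w / 2)‖ ^ n := by
    simpa using (h ⟨w / 2, hhalf⟩).summable.norm
  have hF := ((differentiableOn_tsum_mul_pow hsum).differentiableAt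
    (Metric.isOpen_ball.mem_nhds hball)).comp w (f := fun v ↦ 𝐞(v)) (by fun_prop)
  refine (hF.congr_of_eventuallyEq ?_).differentiableWithinAt
  filter_upwards [isOpen_upperHalfPlaneSet.mem_nhds hw] with v hv
  simpa [ofComplex_apply_of_im_pos hv] using (h ⟨v, hv⟩).tsum_eq.symm

/-- A function with a `q`-expansion which transforms like a modular form of weight `w`, as a
modular form of level one. -/
def modularForm (h : IsQExpansion a f) (w : ℤ) (hf : ∀ M : SL(2, ℤ), f ∣[w] M = f) :
    ModularForm 𝒮ℒ w where
  toFun := f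
  slash_action_eq' := by
    rintro _ ⟨M, rfl⟩
    exact hf M
  holo' := h.mdifferentiable
  bdd_at_cusps' hc := (OnePoint.isBoundedAt_iff_forall_SL2Z hc).mpr fun M _ ↦
    (hf M).symm ▸ h.isBoundedAtImInfty

end IsQExpansion

/-! ### Taylor expansion at `z = 0` -/

section ExponentialSums

variable {ι : Type*} {a : ι → ℂ} {r : ι → ℝ} {g : ℂ → ℂ}

lemma summable_norm_mul_exp_norm (h : ∀ z : ℂ, Summable fun i ↦ a i * Complex.exp (r i * z))
    (z : ℂ) : Summable fun i ↦ ‖a i‖ * Real.exp ‖r i * z‖ := by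
  refine .of_nonneg_of_le (fun i ↦ by positivity) (fun i ↦ ?_)
    ((h ‖z‖).norm.add (h (-‖z‖)).norm)
  have hexp : Real.exp ‖r i * z‖ ≤ Real.exp (r i * ‖z‖) + Real.exp (-(r i * ‖z‖)) := by
    simpa [abs_mul] using Real.exp_abs_le (r i * ‖z‖)
  simpa [Complex.norm_exp, ← mul_add] using mul_le_mul_of_nonneg_left hexp (norm_nonneg (a i))

lemma summable_mul_pow_div_factorial
    (h : ∀ z : ℂ, Summable fun i ↦ a i * Complex.exp (r i * z)) (z : ℂ) :
    Summable fun p : ι × ℕ ↦ a p.1 * ((r p.1 * z) ^ p.2 / p.2.factorial) := by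
  have hexp : ∀ i, HasSum (fun j : ℕ ↦ ‖a i * ((r i * z) ^ j / j.factorial)‖)
      (‖a i‖ * Real.exp ‖r i * z‖) := fun i ↦ by
    have := (NormedSpace.expSeries_div_hasSum_exp ‖r i * z‖).mul_left ‖a i‖
    simpa [← Real.exp_eq_exp_ℝ] using this
  refine .of_norm ((summable_prod_of_nonneg fun _ ↦ norm_nonneg _).mpr
    ⟨fun i ↦ (hexp i).summable, ?_⟩)
  simpa only [(hexp _).tsum_eq] using summable_norm_mul_exp_norm h z

lemma summable_mul_pow (h : ∀ z : ℂ, Summable fun i ↦ a i * Complex.exp (r i * z)) (j : ℕ) :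
    Summable fun i ↦ a i * r i ^ j := by
  have := ((summable_mul_pow_div_factorial h 1).prod_symm.prod_factor j).mul_right (j.factorial : ℂ)
  simpa [mul_assoc, Nat.factorial_ne_zero] using this

lemma hasSum_tsum_mul_pow (h : ∀ z, HasSum (fun i ↦ a i * Complex.exp (r i * z)) (g z)) (z : ℂ) :
    HasSum (fun j : ℕ ↦ (∑' i, a i * r i ^ j) * (z ^ j / j.factorial)) (g z) := by
  have hsum := summable_mul_pow_div_factorial (fun z ↦ (h z).summable) z
  have hg : ∑' p : ι × ℕ, a p.1 * ((r p.1 * z) ^ p.2 / p.2.factorial) = g z := by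
    refine (hsum.hasSum.prod_fiberwise fun i ↦ ?_).unique (h z)
    rw [Complex.exp_eq_exp_ℂ]
    exact (NormedSpace.expSeries_div_hasSum_exp (r i * z)).mul_left (a i)
  rw [← hg, ← (Equiv.prodComm ℕ ι).tsum_eq]
  refine hsum.prod_symm.hasSum.prod_fiberwise fun j ↦ ?_
  refine ((summable_mul_pow (fun z ↦ (h z).summable) j).hasSum.mul_right _).congr_fun fun i ↦ ?_
  rw [Prod.fst_swap, Prod.snd_swap, mul_pow]
  ring

end ExponentialSums

/-- The `j`-th moment `∑ r, c(n, r) rʲ` of the `n`-th row of Fourier coefficients. -/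
def moment (c : ℕ → ℤ → ℂ) (j n : ℕ) : ℂ := ∑' r : ℤ, c n r * r ^ j

/-- The coefficient of `zʲ` in the Taylor expansion at `z = 0` of the Fourier series
`∑ c(n, r) qⁿ ζʳ`, as a function of `τ`. -/
def taylorCoeff (c : ℕ → ℤ → ℂ) (j : ℕ) (τ : ℍ) : ℂ :=
  (∑' p : ℕ × ℤ, c p.1 p.2 * 𝐞(τ) ^ p.1 * p.2 ^ j) * ((2 * π * Complex.I) ^ j / j.factorial)

namespace IsFourierDevelopment

variable {c : ℕ → ℤ → ℂ} {f : ℍ × ℂ → ℂ}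

lemma hasSum_exp_mul (hc : IsFourierDevelopment c f) (τ : ℍ) (z : ℂ) :
    HasSum (fun p : ℕ × ℤ ↦ c p.1 p.2 * 𝐞(τ) ^ p.1 * Complex.exp ((p.2 : ℝ) * z))
      (f (τ, z / (2 * π * Complex.I))) := by
  refine (hc τ (z / (2 * π * Complex.I))).congr_fun fun p ↦ ?_
  rw [mul_div_cancel₀ _ Complex.two_pi_I_ne_zero, ← Complex.exp_int_mul, Complex.ofReal_intCast]

lemma hasSum_taylorCoeff (hc : IsFourierDevelopment c f) (τ : ℍ) (z : ℂ) :
    HasSum (fun j ↦ taylorCoeff c j τ * z ^ j) (f (τ, z)) := by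
  have h := hasSum_tsum_mul_pow (hc.hasSum_exp_mul τ) (2 * π * Complex.I * z)
  rw [mul_div_cancel_left₀ _ Complex.two_pi_I_ne_zero] at h
  refine h.congr_fun fun j ↦ ?_
  simp only [taylorCoeff, Complex.ofReal_intCast, mul_pow]
  ring

lemma isQExpansion_taylorCoeff (hc : IsFourierDevelopment c f) (j : ℕ) :
    IsQExpansion (fun n ↦ moment c j n * ((2 * π * Complex.I) ^ j / j.factorial))
      (taylorCoeff c j) := by
  intro τ
  have hsum : Summable fun p : ℕ × ℤ ↦ c p.1 p.2 * 𝐞(τ) ^ p.1 * p.2 ^ j := by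
    simpa using summable_mul_pow (fun z ↦ (hc.hasSum_exp_mul τ z).summable) j
  have hrow : ∀ n, Summable fun r : ℤ ↦ c n r * r ^ j := fun n ↦ by
    refine ((hsum.prod_factor n).mul_right (𝐞(τ) ^ n)⁻¹).congr fun r ↦ ?_
    field_simp [Complex.exp_ne_zero]
  have hmoment := hsum.hasSum.prod_fiberwise fun n ↦
    ((hrow n).hasSum.mul_right (𝐞(τ) ^ n)).congr_fun fun r ↦ by ring
  refine (hmoment.mul_right _).congr_fun fun n ↦ ?_
  simp only [moment]
  ring

lemma moment_eq_zero (hc : IsFourierDevelopment c f) {j : ℕ} (hj : taylorCoeff c j = 0) :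
    moment c j = 0 := by
  have h := (hj ▸ hc.isQExpansion_taylorCoeff j).eq_zero
  ext n
  simpa [Real.pi_ne_zero, Nat.factorial_ne_zero] using congrFun h n

end IsFourierDevelopment

lemma tendsto_div_pow_of_hasSum {b : ℕ → ℂ} {g : ℂ → ℂ}
    (hg : ∀ z, HasSum (fun j ↦ b j * z ^ j) (g z)) {m : ℕ} (hb : ∀ j < m, b j = 0) :
    Tendsto (fun z ↦ g z / z ^ m) (𝓝[≠] 0) (𝓝 (b m)) := by
  have hsum : Summable fun j ↦ ‖b (j + m)‖ * 1 ^ j := by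
    simpa using (summable_nat_add_iff m).mpr (hg 1).summable.norm
  have hcont := (differentiableOn_tsum_mul_pow hsum).continuousOn.continuousAt
    (Metric.ball_mem_nhds 0 one_pos)
  have hlim : ∑' j, b (j + m) * (0 : ℂ) ^ j = b m := by
    rw [tsum_eq_single 0 fun j hj ↦ by simp [hj]]
    simp
  rw [← hlim]
  refine (hcont.tendsto.mono_left nhdsWithin_le_nhds).congr' ?_
  filter_upwards [self_mem_nhdsWithin] with z hz
  have hhead : ∑ j ∈ Finset.range m, b j * z ^ j = 0 :=
    Finset.sum_eq_zero fun j hj ↦ by rw [hb j (Finset.mem_range.mp hj), zero_mul]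
  rw [eq_div_iff (pow_ne_zero m hz), ← tsum_mul_right, ← (hg z).tsum_eq,
    ← (hg z).summable.sum_add_tsum_nat_add m, hhead, zero_add]
  exact tsum_congr fun j ↦ by ring

/-! ### Vanishing of the Fourier coefficients -/

lemma eq_zero_of_forall_sum_mul_pow_eq_zero {R ι : Type*} [CommRing R] [IsDomain R]
    {s : Finset ι} {v x : ι → R} (hx : Set.InjOn x s)
    (h : ∀ j < s.card, ∑ i ∈ s, v i * x i ^ j = 0) {i : ι} (hi : i ∈ s) : v i = 0 := by
  let e := s.equivFin
  have hv : (fun j ↦ v (e.symm j)) = 0 := by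
    refine Matrix.eq_zero_of_forall_pow_sum_mul_pow_eq_zero (f := fun j ↦ x (e.symm j))
      (hx.injective.comp e.symm.injective) fun j ↦ ?_
    rw [e.symm.sum_comp fun i : s ↦ v i * x i ^ (j : ℕ),
      s.sum_coe_sort fun i ↦ v i * x i ^ (j : ℕ)]
    exact h j j.2
  simpa using congrFun hv (e ⟨i, hi⟩)

section ShiftSymmetry

variable {c : ℕ → ℤ → ℂ} {N : ℕ} {ε : ℂ}

lemma extendCoeff_eq_zero_of_lt {n : ℕ} (hlt : ∀ m < n, c m = 0) {m : ℤ} (hm : m < n) (r : ℤ) :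
    extendCoeff c (m, r) = 0 := by
  rcases lt_or_ge m 0 with hneg | hnonneg
  · exact extendCoeff_of_neg c hneg r
  · lift m to ℕ using hnonneg
    rw [extendCoeff_natCast, hlt m (by exact_mod_cast hm), Pi.zero_apply]

lemma support_row_subset (hε : ε ≠ 0)
    (hsym : ∀ n r : ℤ, extendCoeff c (n, r) = ε * extendCoeff c (n + r, r + N)) {n : ℕ}
    (hlt : ∀ m < n, c m = 0) : Function.support (c n) ⊆ Finset.Icc 0 (N : ℤ) := by
  intro r hr
  rw [Function.mem_support, ← extendCoeff_natCast c] at hr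
  rw [Finset.coe_Icc, Set.mem_Icc]
  by_contra! hout
  refine hr ?_
  rcases lt_or_ge r 0 with hneg | hnonneg
  · rw [hsym, extendCoeff_eq_zero_of_lt hlt (by lia), mul_zero]
  · have hshift := hsym (n - (r - N)) (r - N)
    rw [extendCoeff_eq_zero_of_lt hlt (by lia), sub_add_cancel, sub_add_cancel] at hshift
    exact (mul_eq_zero.mp hshift.symm).resolve_left hε

/-- The shift symmetry confines the lowest nonzero row to `0 ≤ r ≤ N`, where its `N + 1` entries
are determined by the moments. -/
lemma coeff_eq_zero_of_moment_eq_zero (hε : ε ≠ 0)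
    (hsym : ∀ n r : ℤ, extendCoeff c (n, r) = ε * extendCoeff c (n + r, r + N))
    (hmom : ∀ j ≤ N, moment c j = 0) : c = 0 := by
  ext n : 1
  induction n using Nat.strong_induction_on with
  | _ n hlt =>
    have hsupp := support_row_subset hε hsym hlt
    ext r
    by_contra hr
    refine hr (eq_zero_of_forall_sum_mul_pow_eq_zero (s := Finset.Icc 0 (N : ℤ))
      Int.cast_injective.injOn (fun j hj ↦ ?_) (hsupp hr))
    rw [Int.card_Icc] at hj
    exact (tsum_eq_sum' ((Function.support_mul_subset_left _ _).trans hsupp)).symm.trans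
      (congrFun (hmom j (by lia)) n)

end ShiftSymmetry

/-! ### The leading Taylor coefficient -/

section NonpositiveWeight

variable {k : ℤ} {φ : ℍ × ℂ → ℂ} {c : ℕ → ℤ → ℂ} {N : ℕ}

lemma tendsto_div_pow_taylorCoeff (hc : IsFourierDevelopment c fun p ↦ rho p ^ k * φ p) {m : ℕ}
    (hlow : ∀ j < m, taylorCoeff c j = 0) (τ : ℍ) :
    Tendsto (fun z ↦ φ (τ, z) / z ^ m) (𝓝[≠] 0) (𝓝 (taylorCoeff c m τ)) := by
  have hrhoφ := tendsto_div_pow_of_hasSum (hc.hasSum_taylorCoeff τ) (m := m)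
    fun j hj ↦ congrFun (hlow j hj) τ
  have hrho : Tendsto (fun z ↦ rho (τ, z) ^ k) (𝓝[≠] 0) (𝓝 1) := by
    have hcont : Continuous fun z ↦ rho (τ, z) := by
      simp only [rho]
      fun_prop
    simpa [rho] using ((hcont.zpow₀ k fun z ↦ .inl (rho_ne_zero _)).tendsto 0).mono_left
      nhdsWithin_le_nhds
  have hquot := hrhoφ.div hrho one_ne_zero
  rw [div_one] at hquot
  refine hquot.congr fun z ↦ ?_
  rw [Pi.div_apply, mul_div_assoc, mul_div_cancel_left₀ _ (zpow_ne_zero _ (rho_ne_zero _))]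

lemma slash_eq_of_tendsto_div_pow {M : SL(2, ℤ)} (hφ : slashM k M φ = φ) {m : ℕ} {b : ℍ → ℂ}
    (hb : ∀ τ, Tendsto (fun z ↦ φ (τ, z) / z ^ m) (𝓝[≠] 0) (𝓝 (b τ))) : b ∣[k + m] M = b := by
  ext τ
  rw [ModularForm.SL_slash_apply]
  have hd : denom M τ ≠ 0 := denom_ne_zero _ _
  have hscale : Tendsto (fun z : ℂ ↦ z / denom M τ) (𝓝[≠] 0) (𝓝[≠] 0) := by
    refine tendsto_nhdsWithin_iff.mpr ⟨?_, ?_⟩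
    · have hcont : Continuous fun z : ℂ ↦ z / denom M τ := by fun_prop
      simpa using (hcont.tendsto 0).mono_left nhdsWithin_le_nhds
    · filter_upwards [self_mem_nhdsWithin] with z hz using div_ne_zero hz hd
  refine tendsto_nhds_unique
    ((((hb (M • τ)).comp hscale).mul_const (denom M τ ^ (-(k + m)))).congr fun z ↦ ?_) (hb τ)
  have hslash := congrFun hφ (τ, z)
  have hden : (M 1 0 : ℂ) * τ + M 1 1 = denom M τ := by simp [denom]
  simp only [slashM, hden] at hslash
  rw [← hslash, Function.comp_apply, neg_add, zpow_add₀ hd, div_pow, zpow_neg _ (m : ℤ),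
    zpow_natCast]
  field_simp

namespace IsModifiedJacobiForm

lemma exists_isFourierDevelopment (hφ : IsModifiedJacobiForm k ⊤ φ) :
    ∃ c, IsFourierDevelopment c fun p ↦ rho p ^ k * φ p := by
  obtain ⟨-, -, c, -, hc⟩ := hφ.fourier 1
  rw [hφ.slashM_eq 1 trivial] at hc
  exact ⟨c, hc⟩

lemma slash_taylorCoeff (hφ : IsModifiedJacobiForm k ⊤ φ)
    (hc : IsFourierDevelopment c fun p ↦ rho p ^ k * φ p) {m : ℕ}
    (hlow : ∀ j < m, taylorCoeff c j = 0) (M : SL(2, ℤ)) :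
    taylorCoeff c m ∣[k + m] M = taylorCoeff c m :=
  slash_eq_of_tendsto_div_pow (hφ.slashM_eq M trivial) (tendsto_div_pow_taylorCoeff hc hlow)

lemma taylorCoeff_eq_zero (hφ : IsModifiedJacobiForm k ⊤ φ)
    (hc : IsFourierDevelopment c fun p ↦ rho p ^ k * φ p) {m : ℕ} (hm : k + m < 0) :
    taylorCoeff c m = 0 := by
  induction m using Nat.strong_induction_on with
  | _ m ih =>
    exact ModularFormClass.levelOne_neg_weight_eq_zero hm
      ((hc.isQExpansion_taylorCoeff m).modularForm _
        (hφ.slash_taylorCoeff hc fun j hj ↦ ih j hj (by lia)))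

lemma exists_taylorCoeff_eq_const (hφ : IsModifiedJacobiForm (-N) ⊤ φ)
    (hc : IsFourierDevelopment c fun p ↦ rho p ^ (-N : ℤ) * φ p) :
    ∃ b, taylorCoeff c N = Function.const ℍ b := by
  refine ModularFormClass.levelOne_weight_zero_const
    ((hc.isQExpansion_taylorCoeff N).modularForm 0 ?_)
  simpa using hφ.slash_taylorCoeff hc (m := N) fun j hj ↦ hφ.taylorCoeff_eq_zero hc (by lia)

lemma eq_zero_of_taylorCoeff_eq_zero (hφ : IsModifiedJacobiForm (-N) ⊤ φ)
    (hc : IsFourierDevelopment c fun p ↦ rho p ^ (-N : ℤ) * φ p) (hN : taylorCoeff c N = 0) :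
    φ = 0 := by
  have hshift : slashX (-N) 1 0 φ = φ := by simpa using hφ.slashX_eq 1 0
  have hc0 : c = 0 := by
    refine coeff_eq_zero_of_moment_eq_zero (N := N) (ε := (-1) ^ (-N : ℤ))
      (zpow_ne_zero _ (by simp)) (fun n r ↦ ?_) fun j hj ↦ hc.moment_eq_zero ?_
    · simpa using hc.extendCoeff_eq (rho_zpow_mul_add_tau hshift) n r
    · rcases hj.lt_or_eq with hlt | rfl
      · exact hφ.taylorCoeff_eq_zero hc (by lia)
      · exact hN
  ext ⟨τ, z⟩
  have hsum := hc τ z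
  simp only [hc0, Pi.zero_apply, zero_mul] at hsum
  exact (mul_eq_zero.mp (hsum.unique hasSum_zero)).resolve_left (zpow_ne_zero _ (rho_ne_zero _))

lemma exists_tendsto_div_pow (hφ : IsModifiedJacobiForm (-N) ⊤ φ) :
    ∃ b, (∀ τ, Tendsto (fun z ↦ φ (τ, z) / z ^ N) (𝓝[≠] 0) (𝓝 b)) ∧ (b = 0 → φ = 0) := by
  obtain ⟨c, hc⟩ := hφ.exists_isFourierDevelopment
  obtain ⟨b, hb⟩ := hφ.exists_taylorCoeff_eq_const hc
  refine ⟨b, fun τ ↦ ?_, fun hb0 ↦ hφ.eq_zero_of_taylorCoeff_eq_zero hc (hb.trans ?_)⟩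
  · simpa [hb] using
      tendsto_div_pow_taylorCoeff hc (m := N) (fun j hj ↦ hφ.taylorCoeff_eq_zero hc (by lia)) τ
  · rw [hb0]
    rfl

end IsModifiedJacobiForm

end NonpositiveWeight

lemma tendsto_div_pow_limUnder {N : ℕ} (φ : J (-N) ⊤) : Tendsto (fun z ↦ φ.1 (I, z) / z ^ N)
    (𝓝[≠] 0) (𝓝 (limUnder (𝓝[≠] 0) fun z ↦ φ.1 (I, z) / z ^ N)) :=
  tendsto_nhds_limUnder ((IsModifiedJacobiForm.exists_tendsto_div_pow φ.2).imp fun _ h ↦ h.1 I)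

/-- The coefficient of `z ^ N` in the Taylor expansion at `z = 0` of a form of weight `-N`, which
begins with this term. The coefficient does not depend on `τ`, so it is read off at `τ = i`. -/
def leadingCoeff (N : ℕ) : J (-N) ⊤ →ₗ[ℂ] ℂ where
  toFun φ := limUnder (𝓝[≠] 0) fun z ↦ φ.1 (I, z) / z ^ N
  map_add' φ ψ := Tendsto.limUnder_eq <| by
    simpa [add_div] using (tendsto_div_pow_limUnder φ).add (tendsto_div_pow_limUnder ψ)
  map_smul' a φ := Tendsto.limUnder_eq <| by
    simpa [mul_div_assoc] using (tendsto_div_pow_limUnder φ).const_mul a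

lemma leadingCoeff_injective (N : ℕ) : Function.Injective (leadingCoeff N) := by
  refine (injective_iff_map_eq_zero _).mpr fun φ hφ ↦ Subtype.ext ?_
  obtain ⟨b, hb, hb0⟩ := IsModifiedJacobiForm.exists_tendsto_div_pow φ.2
  exact hb0 ((hb I).limUnder_eq.symm.trans hφ)

end ModifiedJacobi

end

theorem theorem4p6_general (k : ℤ) (hk : k ≤ 0) :
    Module.rank ℂ (ModifiedJacobi.J k ⊤) ≤ 1 := by
  obtain ⟨N, rfl⟩ := Int.exists_eq_neg_ofNat hk
  simpa using LinearMap.rank_le_of_injective _ (ModifiedJacobi.leadingCoeff_injective N)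

theorem theorem4p6 (k m : ℤ) (hk : k < 0) (hm : 0 < m) :
    FiniteDimensional ℂ (ModifiedJacobi.Jm k m) := by
  have : FiniteDimensional ℂ (ModifiedJacobi.J k ⊤) :=
    Module.rank_lt_aleph0_iff.mp ((theorem4p6_general k hk.le).trans_lt Cardinal.one_lt_aleph0)
  exact Submodule.finiteDimensional_of_le fun _ hφ ↦ hφ.1
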